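/- Let $G$ be a Lie group whose Lie algebra $\mathfrak g$ is semisimple, let $\mathfrak g=\mathfrak g_{-1}\oplus\mathfrak g_0\oplus\mathfrak g_1$ be a $|1|$-grading (so $[\mathfrak g_i,\mathfrak g_j]\subset\mathfrak g_{i+j}$, with $\mathfrak g_i=0$ for $|i|>1$, and $\mathfrak g_{-1}\neq 0$), and let $P\subset G$ be the corresponding parabolic subgroup, i.e. the Lie subgroup of all $g\in G$ such that $\mathrm{Ad}_g$ preserves $\mathfrak g_0\oplus\mathfrak g_1$ and $\mathfrak g_1$. Assume that the only normal subgroup of $G$ contained in $P$ is the trivial one. Let $(\mathcal B\to M,\omega)$ be a Cartan geometry of type $(G,P)$ (a $|1|$-graded parabolic geometry) on a connected smooth manifold $M$: $\mathcal B\to M$ is a smooth principal $P$-bundle and $\omega\in\Omega^1(\mathcal B,\mathfrak g)$ is $P$-equivariant, reproduces the generators of fundamental vector fields and restricts to a linear isomorphism $T_u\mathcal B\cong\mathfrak g$ for each $u\in\mathcal B$. An automorphism is a $P$-equivariant diffeomorphism $\varphi$ of $\mathcal B$ with $\varphi^*\omega=\omega$; it covers a diffeomorphism of $M$. A symmetry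 centered at $x\in M$ is a diffeomorphism $s$ of $M$ with $s(x)=x$ and $T_xs=-\mathrm{id}$ on $T_xM$ that is covered by an automorphism. Let $H$ be a (second countable) Lie group acting smoothly and transitively on $M$ such that every element of $H$, viewed as a diffeomorphism of $M$, is covered by an automorphism of $(\mathcal B\to M,\omega)$. Suppose that for some $x_0\in M$ there is a symmetry $s_{x_0}$ centered at $x_0$ such that $k\circ s_{x_0}\circ k^{-1}=s_{x_0}$ for all $k\in H$ with $k(x_0)=x_0$. Then there is a well-defined system of symmetries $(s_x)_{x\in M}$ given by $$s_x=h\circ s_{x_0}\circ h^{-1}\qquad\text{whenever } x=h(x_0),\ h\in H,$$ where each $s_x$ is a symmetry centered at $x$, and it is smooth: the map $S:M\times M\to M$, $S(x,y)=s_x(y)$, is smooth. -/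

import Mathlib

open scoped Manifold ContDiff
open Manifold

/-- The bracket of the Lie algebra of a real Lie group needs three derivatives, which smooth Lie
groups have. -/
instance instLEInftyMinSmoothnessThree : ENat.LEInfty (minSmoothness ℝ 3) :=
  ⟨by rw [minSmoothness_of_isRCLikeNormedField]; exact ENat.LEInfty.out⟩

noncomputable section

/-! ### The type `(G, P)` of a `|1|`-graded parabolic geometry -/

/-- A `|1|`-grading `𝔤 = 𝔤₋₁ ⊕ 𝔤₀ ⊕ 𝔤₁` of a real Lie algebra, written as a grading by `ℤ` that is
concentrated in the degrees `-1, 0, 1`. -/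
structure OneGrading (𝔤 : Type*) [LieRing 𝔤] [LieAlgebra ℝ 𝔤] where
  part : ℤ → Submodule ℝ 𝔤
  isInternal : DirectSum.IsInternal part
  lie_mem : ∀ i j : ℤ, ∀ X ∈ part i, ∀ Y ∈ part j, ⁅X, Y⁆ ∈ part (i + j)
  part_eq_bot : ∀ i : ℤ, 1 < |i| → part i = ⊥
  part_neg_one_ne_bot : part (-1) ≠ ⊥

/-- The filtration `𝔤ⁱ = 𝔤ᵢ ⊕ 𝔤ᵢ₊₁ ⊕ ⋯` of a graded Lie algebra. -/
def OneGrading.filtration {𝔤 : Type*} [LieRing 𝔤] [LieAlgebra ℝ 𝔤] (gr : OneGrading 𝔤) (i : ℤ) :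
    Submodule ℝ 𝔤 :=
  ⨆ j : ℤ, ⨆ _ : i ≤ j, gr.part j

section Adjoint

variable {EG G : Type*} [NormedAddCommGroup EG] [NormedSpace ℝ EG]
  [TopologicalSpace G] [ChartedSpace EG G] [Group G]

/-- The adjoint action of a Lie group on its Lie algebra: the derivative at `1` of `x ↦ g x g⁻¹`. -/
def adjointAction (g : G) : GroupLieAlgebra 𝓘(ℝ, EG) G →L[ℝ] GroupLieAlgebra 𝓘(ℝ, EG) G :=
  mfderiv 𝓘(ℝ, EG) 𝓘(ℝ, EG) (fun x : G => g * x * g⁻¹) 1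

/-- The derivative of `x ↦ g x g⁻¹` takes values in the tangent space at `g 1 g⁻¹`, which is the
tangent space at `1`. -/
theorem tangentMap_conj_one (g : G) (X : GroupLieAlgebra 𝓘(ℝ, EG) G) :
    tangentMap 𝓘(ℝ, EG) 𝓘(ℝ, EG) (fun x : G => g * x * g⁻¹) ⟨1, X⟩ =
      (⟨1, adjointAction g X⟩ : TangentBundle 𝓘(ℝ, EG) G) := by
  refine Bundle.TotalSpace.ext ?_ ?_
  · simp [tangentMap]
  · exact heq_of_eq rfl

end Adjoint

/-- `ι : P → G` embeds `P` as a Lie subgroup of `G`, and its image is the parabolic subgroup given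
by the grading of the Lie algebra of `G`: the group of all elements whose adjoint action preserves
the filtration. -/
structure IsParabolicSubgroup
    {EG G EP P : Type*} [NormedAddCommGroup EG] [NormedSpace ℝ EG] [FiniteDimensional ℝ EG]
    [TopologicalSpace G] [ChartedSpace EG G] [Group G] [LieGroup 𝓘(ℝ, EG) ∞ G]
    [NormedAddCommGroup EP] [NormedSpace ℝ EP]
    [TopologicalSpace P] [ChartedSpace EP P] [Group P]
    (gr : OneGrading (GroupLieAlgebra 𝓘(ℝ, EG) G)) (ι : P →* G) : Prop where
  isSmoothEmbedding : IsSmoothEmbedding 𝓘(ℝ, EP) 𝓘(ℝ, EG) ∞ ι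
  mem_range_iff : ∀ g : G, g ∈ ι.range ↔
    ∀ i : ℤ, ∀ X ∈ gr.filtration i, adjointAction g X ∈ gr.filtration i

/-- The pair `P ⊆ G` is effective: the kernel, i.e. the largest normal subgroup of `G` contained
in `P`, is trivial. -/
def IsEffectivePair {G P : Type*} [Group G] [Group P] (ι : P →* G) : Prop :=
  ∀ N : Subgroup G, N.Normal → N ≤ ι.range → N = ⊥

/-! ### Cartan geometries -/

/-- A smooth principal (right) `P`-bundle `B → M`. -/
structure SmoothPrincipalBundle
    {EP : Type*} [NormedAddCommGroup EP] [NormedSpace ℝ EP]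
    (P : Type*) [TopologicalSpace P] [ChartedSpace EP P] [Group P]
    {EB : Type*} [NormedAddCommGroup EB] [NormedSpace ℝ EB]
    (B : Type*) [TopologicalSpace B] [ChartedSpace EB B]
    {EM : Type*} [NormedAddCommGroup EM] [NormedSpace ℝ EM]
    (M : Type*) [TopologicalSpace M] [ChartedSpace EM M] where
  /-- The bundle projection. -/
  proj : B → M
  /-- The principal right action `u · p`. -/
  act : B → P → B
  contMDiff_proj : ContMDiff 𝓘(ℝ, EB) 𝓘(ℝ, EM) ∞ proj
  contMDiff_act : ContMDiff (𝓘(ℝ, EB).prod 𝓘(ℝ, EP)) 𝓘(ℝ, EB) ∞ (fun q : B × P => act q.1 q.2)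
  act_one : ∀ u : B, act u 1 = u
  act_mul : ∀ (u : B) (p q : P), act u (p * q) = act (act u p) q
  proj_act : ∀ (u : B) (p : P), proj (act u p) = proj u
  /-- Over a neighbourhood `U` of each point, `B` is equivariantly diffeomorphic to `U × P`. -/
  exists_trivialization : ∀ x : M, ∃ (U : Set M)
    (Φ : PartialDiffeomorph 𝓘(ℝ, EB) (𝓘(ℝ, EM).prod 𝓘(ℝ, EP)) B (M × P) ∞),
    IsOpen U ∧ x ∈ U ∧ Φ.source = proj ⁻¹' U ∧ Φ.target = U ×ˢ Set.univ ∧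
      (∀ u ∈ Φ.source, (Φ u).1 = proj u) ∧
      (∀ u ∈ Φ.source, ∀ p : P, Φ (act u p) = (proj u, (Φ u).2 * p))

/-- A Cartan geometry `(B → M, ω)` of type `(G, P)`, where `ι : P → G` is the inclusion. -/
structure CartanGeometry
    {EG G EP P : Type*} [NormedAddCommGroup EG] [NormedSpace ℝ EG]
    [TopologicalSpace G] [ChartedSpace EG G] [Group G]
    [NormedAddCommGroup EP] [NormedSpace ℝ EP]
    [TopologicalSpace P] [ChartedSpace EP P] [Group P]
    (ι : P →* G)
    {EB : Type*} [NormedAddCommGroup EB] [NormedSpace ℝ EB]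
    (B : Type*) [TopologicalSpace B] [ChartedSpace EB B] [IsManifold 𝓘(ℝ, EB) ∞ B]
    {EM : Type*} [NormedAddCommGroup EM] [NormedSpace ℝ EM]
    (M : Type*) [TopologicalSpace M] [ChartedSpace EM M]
    extends SmoothPrincipalBundle (EP := EP) P (EB := EB) B (EM := EM) M where
  /-- The Cartan connection `ω`, a one-form on `B` with values in the Lie algebra of `G`. -/
  conn : ∀ u : B, TangentSpace 𝓘(ℝ, EB) u →L[ℝ] GroupLieAlgebra 𝓘(ℝ, EG) G
  /-- The one-form is smooth, i.e. smooth as a function on the tangent bundle of `B`; here the Lie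
  algebra of `G` is seen as the vector space `EG` on which `G` is modelled. -/
  contMDiff_conn : ContMDiff (M' := EG) 𝓘(ℝ, EB).tangent 𝓘(ℝ, EG) ∞
    (fun v : TangentBundle 𝓘(ℝ, EB) B => conn v.proj v.snd)
  /-- `(r^p)^* ω = Ad(p⁻¹) ∘ ω`, where `r^p` is the action of `p`. -/
  equivariant : ∀ (u : B) (p : P) (v : TangentSpace 𝓘(ℝ, EB) u),
    conn (act u p) (mfderiv 𝓘(ℝ, EB) 𝓘(ℝ, EB) (fun u' : B => act u' p) u v) =
      adjointAction (ι p)⁻¹ (conn u v)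
  /-- `ω` maps the value at `u` of the fundamental field of `X` to `X`, where `X` in the Lie
  algebra of `P` is seen as an element of the Lie algebra of `G` through the derivative of `ι`. -/
  fundamental : ∀ (u : B) (X : GroupLieAlgebra 𝓘(ℝ, EP) P),
    (⟨1, conn (act u 1) (mfderiv 𝓘(ℝ, EP) 𝓘(ℝ, EB) (fun p : P => act u p) 1 X)⟩ :
        TangentBundle 𝓘(ℝ, EG) G) =
      tangentMap 𝓘(ℝ, EP) 𝓘(ℝ, EG) ι ⟨1, X⟩
  /-- `ω` is an absolute parallelism. -/
  bijective : ∀ u : B, Function.Bijective (conn u)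

namespace CartanGeometry

variable {EG G EP P : Type*} [NormedAddCommGroup EG] [NormedSpace ℝ EG]
  [TopologicalSpace G] [ChartedSpace EG G] [Group G]
  [NormedAddCommGroup EP] [NormedSpace ℝ EP]
  [TopologicalSpace P] [ChartedSpace EP P] [Group P]
  {ι : P →* G}
  {EB B : Type*} [NormedAddCommGroup EB] [NormedSpace ℝ EB]
  [TopologicalSpace B] [ChartedSpace EB B] [IsManifold 𝓘(ℝ, EB) ∞ B]
  {EM M : Type*} [NormedAddCommGroup EM] [NormedSpace ℝ EM]
  [TopologicalSpace M] [ChartedSpace EM M]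

/-- Automorphisms of a Cartan geometry: diffeomorphisms `φ` of `B` that commute with the principal
action and satisfy `φ^* ω = ω`. -/
structure IsAutomorphism (𝒢 : CartanGeometry (EG := EG) (EP := EP) ι (EB := EB) B (EM := EM) M)
    (φ : B ≃ₘ^∞⟮𝓘(ℝ, EB), 𝓘(ℝ, EB)⟯ B) : Prop where
  map_act : ∀ (u : B) (p : P), φ (𝒢.act u p) = 𝒢.act (φ u) p
  map_conn : ∀ (u : B) (v : TangentSpace 𝓘(ℝ, EB) u),
    𝒢.conn (φ u) (mfderiv 𝓘(ℝ, EB) 𝓘(ℝ, EB) φ u v) = 𝒢.conn u v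

/-- A map `f` of the base is covered by an automorphism of the Cartan geometry. -/
def IsCoveredByAutomorphism
    (𝒢 : CartanGeometry (EG := EG) (EP := EP) ι (EB := EB) B (EM := EM) M) (f : M → M) : Prop :=
  ∃ φ : B ≃ₘ^∞⟮𝓘(ℝ, EB), 𝓘(ℝ, EB)⟯ B, 𝒢.IsAutomorphism φ ∧ ∀ u : B, 𝒢.proj (φ u) = f (𝒢.proj u)

/-- A symmetry centered at `x`: a diffeomorphism `s` of `M` with `s x = x` and `T_x s = -id` which
is covered by an automorphism. -/
structure IsSymmetry (𝒢 : CartanGeometry (EG := EG) (EP := EP) ι (EB := EB) B (EM := EM) M)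
    (x : M) (s : M ≃ₘ^∞⟮𝓘(ℝ, EM), 𝓘(ℝ, EM)⟯ M) : Prop where
  map_center : s x = x
  tangentMap_eq : ∀ v : TangentSpace 𝓘(ℝ, EM) x,
    tangentMap 𝓘(ℝ, EM) 𝓘(ℝ, EM) s ⟨x, v⟩ = ⟨x, -v⟩
  covered : 𝒢.IsCoveredByAutomorphism s

/-- A smooth system of symmetries: a symmetry `s_x` at each point `x` such that
`S(x, y) = s_x(y)` is smooth on `M × M`. -/
structure IsSmoothSystem (𝒢 : CartanGeometry (EG := EG) (EP := EP) ι (EB := EB) B (EM := EM) M)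
    (S : M → M ≃ₘ^∞⟮𝓘(ℝ, EM), 𝓘(ℝ, EM)⟯ M) : Prop where
  isSymmetry : ∀ x : M, 𝒢.IsSymmetry x (S x)
  contMDiff : ContMDiff (𝓘(ℝ, EM).prod 𝓘(ℝ, EM)) 𝓘(ℝ, EM) ∞ (fun q : M × M => S q.1 q.2)

end CartanGeometry

end

/-! Two choices of `h` with `h • x₀ = x` differ by an element of the stabilizer of `x₀`, which
commutes with `s`; hence `s_x` depends only on `x`. Conjugation by `h` carries automorphisms to
automorphisms, and by linearity `T h ∘ (-id) ∘ T h⁻¹ = -id`, so `s_x` is a symmetry.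

For smoothness, let `σ` be a smooth local section of the orbit map `h ↦ h • x₀`. Then locally `S (x,
y) = σ x • s ((σ x)⁻¹ • y)`, which is smooth in both variables.

The section comes from openness of the orbit map, a Baire category fact for a σ-compact group. A
smooth open map has surjective derivative somewhere: near a point of maximal rank the map depends
only on the projection of its value to the range of the derivative, so its image cannot be open
unless that range is everything. The inverse function theorem gives a section there, and homogeneity
moves it to every point. -/

/-! ### Smooth open maps between vector spaces -/

section Calculus

open scoped Topology

variable {E F : Type*} [NormedAddCommGroup E] [NormedSpace ℝ E]
  [NormedAddCommGroup F] [NormedSpace ℝ F] [FiniteDimensional ℝ F]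

/-- A smooth map whose derivative at a point is surjective has a smooth local section through
that point. -/
theorem ContDiffAt.exists_local_section {f : E → F} {e : E} (hf : ContDiffAt ℝ ∞ f e)
    (hsurj : Function.Surjective (fderiv ℝ f e)) :
    ∃ σ : F → E, ContDiffAt ℝ ∞ σ (f e) ∧ σ (f e) = e ∧ ∀ᶠ y in 𝓝 (f e), f (σ y) = y := by
  have : CompleteSpace F := FiniteDimensional.complete ℝ F
  obtain ⟨R, hR⟩ := (fderiv ℝ f e).toLinearMap.exists_rightInverse_of_surjective
    (LinearMap.range_eq_top.2 hsurj)
  let R' : F →L[ℝ] E := LinearMap.toContinuousLinearMap R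
  have hRR : ∀ y, fderiv ℝ f e (R' y) = y := fun y => LinearMap.congr_fun hR y
  -- Restricted to the affine slice through `e` along a right inverse of the derivative, `f` has
  -- derivative the identity, so the inverse function theorem applies.
  let j : F → E := fun y => e + R' y
  have hj0 : j 0 = e := by simp [j]
  have hj : ContDiff ℝ ∞ j := contDiff_const.add R'.contDiff
  have hjd : HasFDerivAt j R' 0 := R'.hasFDerivAt.const_add e
  have hg : ContDiffAt ℝ ∞ (f ∘ j) 0 := ContDiffAt.comp 0 (by rwa [hj0]) hj.contDiffAt
  have hfd : HasFDerivAt f (fderiv ℝ f e) (j 0) := by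
    rw [hj0]; exact (hf.differentiableAt (by simp)).hasFDerivAt
  have hgd : HasFDerivAt (f ∘ j) ((ContinuousLinearEquiv.refl ℝ F : F ≃L[ℝ] F) : F →L[ℝ] F) 0 := by
    refine (hfd.comp 0 hjd).congr_fderiv ?_
    ext y
    exact hRR y
  have hgj : (f ∘ j) 0 = f e := by simp [hj0]
  have hn : (∞ : WithTop ℕ∞) ≠ 0 := by simp
  have hinv := hg.to_localInverse hgd hn
  have hinv0 := hg.localInverse_apply_image hgd hn
  have hright := (hg.hasStrictFDerivAt' hgd hn).eventually_right_inverse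
  rw [hgj] at hinv hinv0 hright
  refine ⟨j ∘ hg.localInverse hgd hn, hj.contDiffAt.comp _ hinv, ?_, ?_⟩
  · simp [hinv0, hj0]
  · exact hright

/-- A smooth map on an open set which sends open subsets to open sets has a point at which its
derivative is surjective. -/
theorem ContDiffOn.exists_surjective_fderiv_of_isOpen_image [FiniteDimensional ℝ E] {f : E → F} {U : Set E}
    (hU : IsOpen U) (hne : U.Nonempty) (hf : ContDiffOn ℝ ∞ f U)
    (hopen : ∀ V ⊆ U, IsOpen V → IsOpen (f '' V)) :
    ∃ e ∈ U, Function.Surjective (fderiv ℝ f e) := by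
  have : CompleteSpace E := FiniteDimensional.complete ℝ E
  have hn : (∞ : WithTop ℕ∞) ≠ 0 := by simp
  let rk : E → ℕ := fun x => Module.finrank ℝ (LinearMap.range (fderiv ℝ f x).toLinearMap)
  -- Ranks are bounded by `finrank ℝ F`, so the maximum is attained; what follows is the constant
  -- rank argument at `e`.
  obtain ⟨e, heU, hmax⟩ : ∃ e ∈ U, ∀ x ∈ U, rk x ≤ rk e := by
    have hfin : (rk '' U).Finite := (Set.finite_Iic (Module.finrank ℝ F)).subset (by
      rintro _ ⟨x, -, rfl⟩
      exact Submodule.finrank_le _)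
    obtain ⟨_, ⟨e, he, rfl⟩, h⟩ := Set.exists_max_image (rk '' U) id hfin (hne.image _)
    exact ⟨e, he, fun x hx => h _ ⟨x, hx, rfl⟩⟩
  refine ⟨e, heU, ?_⟩
  have hfe : ∀ x ∈ U, HasFDerivAt f (fderiv ℝ f x) x := fun x hx =>
    ((hf.contDiffAt (hU.mem_nhds hx)).differentiableAt hn).hasFDerivAt
  let A := LinearMap.range (fderiv ℝ f e).toLinearMap
  let K := LinearMap.ker (fderiv ℝ f e).toLinearMap
  obtain ⟨p₀, hp₀⟩ := A.subtype.exists_leftInverse_of_injective A.ker_subtype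
  obtain ⟨q₀, hq₀⟩ := K.subtype.exists_leftInverse_of_injective K.ker_subtype
  let p : F →L[ℝ] A := LinearMap.toContinuousLinearMap p₀
  let q : E →L[ℝ] K := LinearMap.toContinuousLinearMap q₀
  have hp : ∀ a : A, p a = a := fun a => LinearMap.congr_fun hp₀ a
  have hq : ∀ k : K, q k = k := fun k => LinearMap.congr_fun hq₀ k
  -- Straightening coordinates: `p` projects onto the range and `q` onto the kernel of the
  -- derivative at `e`, which makes the derivative of `Φ` at `e` injective, hence bijective by
  -- rank-nullity.
  let Φ : E → A × K := fun x => (p (f x), q x)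
  let D : E → E →L[ℝ] A × K := fun x => (p.comp (fderiv ℝ f x)).prod q
  have hΦD : ∀ x ∈ U, HasFDerivAt Φ (D x) x := fun x hx =>
    (p.hasFDerivAt.comp x (hfe x hx)).prodMk q.hasFDerivAt
  have hΦ : ContDiffAt ℝ ∞ Φ e :=
    (p.contDiff.contDiffAt.comp e (hf.contDiffAt (hU.mem_nhds heU))).prodMk q.contDiff.contDiffAt
  have hinj : Function.Injective (D e) := by
    rw [injective_iff_map_eq_zero]
    intro v hv
    have h1 : p (fderiv ℝ f e v) = 0 := congrArg Prod.fst hv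
    have h2 : q v = 0 := congrArg Prod.snd hv
    have h3 := hp ⟨fderiv ℝ f e v, v, rfl⟩
    rw [show p ((⟨fderiv ℝ f e v, v, rfl⟩ : A) : F) = 0 from h1] at h3
    have h4 : v ∈ K := (congrArg Subtype.val h3).symm
    have h5 := hq ⟨v, h4⟩
    rw [show q ((⟨v, h4⟩ : K) : E) = 0 from h2] at h5
    exact (congrArg Subtype.val h5).symm
  have hdim : Module.finrank ℝ E = Module.finrank ℝ (A × K) := by
    rw [Module.finrank_prod]
    exact (LinearMap.finrank_range_add_finrank_ker (fderiv ℝ f e).toLinearMap).symm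
  let De : E ≃L[ℝ] A × K :=
    (LinearEquiv.ofInjectiveOfFinrankEq (D e).toLinearMap hinj hdim).toContinuousLinearEquiv
  have hDe : (De : E →L[ℝ] A × K) = D e := by ext v <;> rfl
  have hΦDe : HasFDerivAt Φ (De : E →L[ℝ] A × K) e := by rw [hDe]; exact hΦD e heU
  have hDcont : ContinuousAt D e := by
    have h1 : ContinuousAt (fderiv ℝ f) e :=
      (hf.contDiffAt (hU.mem_nhds heU)).continuousAt_fderiv hn
    have h2 : ContinuousAt (fun x => (p.comp (fderiv ℝ f x), q)) e :=
      ((ContinuousLinearMap.compL ℝ E F A p).continuous.continuousAt.comp h1).prodMk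
        continuousAt_const
    exact ContinuousAt.comp (f := fun x => (p.comp (fderiv ℝ f x), q))
      (ContinuousLinearMap.prodₗᵢ ℝ).continuous.continuousAt h2
  have hW : ∀ᶠ x in 𝓝 e, x ∈ U ∧ ∃ Dx : E ≃L[ℝ] A × K, (Dx : E →L[ℝ] A × K) = D x := by
    have h : Set.range ((↑) : (E ≃L[ℝ] A × K) → E →L[ℝ] A × K) ∈ 𝓝 (D e) := by
      rw [← hDe]
      exact ContinuousLinearEquiv.nhds De
    exact Filter.Eventually.and (hU.mem_nhds heU) (hDcont.eventually h)
  obtain ⟨W, hWsub, hWo, heW⟩ := eventually_nhds_iff.1 hW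
  -- Composing with `p` still gives rank `finrank ℝ A`, the maximum, so it cannot enlarge the kernel
  -- of the derivative at `x`.
  have hker : ∀ x ∈ W, ∀ v, p (fderiv ℝ f x v) = 0 → fderiv ℝ f x v = 0 := by
    intro x hx v hv
    obtain ⟨hxU, Dx, hDx⟩ := hWsub x hx
    have hs : Function.Surjective (p.comp (fderiv ℝ f x)) := by
      intro a
      obtain ⟨w, hw⟩ := Dx.surjective (a, 0)
      refine ⟨w, ?_⟩
      have : D x w = (a, 0) := by rw [← hDx]; exact hw
      exact congrArg Prod.fst this
    have r1 := LinearMap.finrank_range_add_finrank_ker (fderiv ℝ f x).toLinearMap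
    have r2 := LinearMap.finrank_range_add_finrank_ker (p.comp (fderiv ℝ f x)).toLinearMap
    rw [LinearMap.range_eq_top.2 (show Function.Surjective (p.comp (fderiv ℝ f x)).toLinearMap
      from hs), finrank_top] at r2
    have r3 : rk x ≤ Module.finrank ℝ A := hmax x hxU
    have hle : LinearMap.ker (fderiv ℝ f x).toLinearMap ≤
        LinearMap.ker (p.comp (fderiv ℝ f x)).toLinearMap := by
      intro w hw
      have hw' : fderiv ℝ f x w = 0 := hw
      show p (fderiv ℝ f x w) = 0
      rw [hw', map_zero]
    have heq := Submodule.eq_of_le_of_finrank_le hle (by simp only [rk] at r3; omega)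
    have : v ∈ LinearMap.ker (p.comp (fderiv ℝ f x)).toLinearMap := hv
    rw [← heq] at this
    exact this
  let Ψ := hΦ.toOpenPartialHomeomorph Φ hΦDe hn
  have hΨ : ∀ x, Ψ x = Φ x := fun x => rfl
  have heΨ : e ∈ Ψ.source := hΦ.mem_toOpenPartialHomeomorph_source hΦDe hn
  have hTo : IsOpen (Ψ.target ∩ Ψ.symm ⁻¹' W) := Ψ.isOpen_inter_preimage_symm hWo
  obtain ⟨ε, hε, hball⟩ := Metric.isOpen_iff.1 hTo (Φ e)
    ⟨Ψ.map_source heΨ, by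
      show Ψ.symm (Ψ e) ∈ W
      rw [Ψ.left_inv heΨ]; exact heW⟩
  -- In the coordinates `Φ`, moving along `K` leaves `p ∘ f` fixed, so by `hker` the derivative of
  -- `f` vanishes in that direction; the slice is a ball, hence convex.
  have hfib : ∀ k ∈ Metric.ball (q e) ε,
      f (Ψ.symm (p (f e), k)) = f (Ψ.symm (p (f e), q e)) := by
    have hmem : ∀ k ∈ Metric.ball (q e) ε, (p (f e), k) ∈ Ψ.target ∩ Ψ.symm ⁻¹' W := by
      intro k hk
      apply hball
      rw [Metric.mem_ball, Prod.dist_eq]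
      exact max_lt (by simpa [Φ] using hε) hk
    have hder : ∀ k ∈ Metric.ball (q e) ε,
        HasFDerivAt (fun k => f (Ψ.symm (p (f e), k))) (0 : K →L[ℝ] F) k := by
      intro k hk
      obtain ⟨ht, hw⟩ := hmem k hk
      obtain ⟨hxU, Dx, hDx⟩ := hWsub _ hw
      have h1 := Ψ.hasFDerivAt_symm (f' := Dx) ht (by rw [hDx]; exact hΦD _ hxU)
      have h2 := (hfe _ hxU).comp k (h1.comp k (hasFDerivAt_prodMk_right (p (f e)) k))
      refine h2.congr_fderiv ?_
      ext w
      refine hker _ hw (Dx.symm (0, w)) ?_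
      have : D (Ψ.symm (p (f e), k)) (Dx.symm (0, w)) = (0, w) := by
        rw [← hDx]; exact Dx.apply_symm_apply _
      exact congrArg Prod.fst this
    intro k hk
    exact (convex_ball (q e) ε).is_const_of_fderivWithin_eq_zero (𝕜 := ℝ)
      (f := fun k => f (Ψ.symm (p (f e), k)))
      (fun k hk => (hder k hk).differentiableAt.differentiableWithinAt)
      (fun k hk => (hder k hk).hasFDerivWithinAt.fderivWithin
        (Metric.isOpen_ball.uniqueDiffWithinAt hk)) hk (Metric.mem_ball_self hε)
  have hVo : IsOpen (Ψ.source ∩ Ψ ⁻¹' Metric.ball (Φ e) ε) :=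
    Ψ.isOpen_inter_preimage Metric.isOpen_ball
  have hVU : Ψ.source ∩ Ψ ⁻¹' Metric.ball (Φ e) ε ⊆ U := by
    rintro x ⟨hx, hxb⟩
    have := (hball hxb).2
    rw [Set.mem_preimage, Ψ.left_inv hx] at this
    exact (hWsub x this).1
  have hconst : ∀ x ∈ Ψ.source ∩ Ψ ⁻¹' Metric.ball (Φ e) ε, p (f x) = p (f e) → f x = f e := by
    rintro x ⟨hx, hxb⟩ hpx
    have hk : q x ∈ Metric.ball (q e) ε := by
      rw [Set.mem_preimage, Metric.mem_ball, Prod.dist_eq] at hxb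
      exact (max_lt_iff.1 hxb).2
    have h1 := hfib _ hk
    rw [← hpx, show (p (f x), q x) = Ψ x from rfl, Ψ.left_inv hx, hpx,
      show (p (f e), q e) = Ψ e from rfl, Ψ.left_inv heΨ] at h1
    exact h1
  have himage := (hopen _ hVU hVo).mem_nhds
    ⟨e, ⟨heΨ, Metric.mem_ball_self hε⟩, rfl⟩
  -- The image is a neighbourhood of `f e`, so it contains `f e + t • w` for some `t ≠ 0`. This
  -- value has the same `p`-component as `f e`, hence equals it by `hconst`.
  have hpinj : ∀ w, p w = 0 → w = 0 := by
    intro w hw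
    have hlim : Filter.Tendsto (fun t : ℝ => f e + t • w) (𝓝[≠] 0) (𝓝 (f e)) := by
      have : Continuous (fun t : ℝ => f e + t • w) := by fun_prop
      have h := this.tendsto 0
      simp only [zero_smul, add_zero] at h
      exact h.mono_left nhdsWithin_le_nhds
    obtain ⟨t, ⟨x, hxV, hx⟩, ht⟩ := ((hlim.eventually himage).and self_mem_nhdsWithin).exists
    have h1 : f x = f e := hconst x hxV (by rw [hx]; simp [hw])
    rw [h1] at hx
    have h2 : t • w = 0 := by simpa using hx.symm
    exact (smul_eq_zero.1 h2).resolve_left ht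
  intro y
  have : y - (p y : F) = 0 := hpinj _ (by rw [map_sub, hp, sub_self])
  obtain ⟨v, hv⟩ := (p y).2
  exact ⟨v, hv.trans (sub_eq_zero.1 this).symm⟩

end Calculus

/-! ### Local sections of open maps and of orbit maps -/

section Manifold

open scoped Topology

variable {E F : Type*} [NormedAddCommGroup E] [NormedSpace ℝ E] [FiniteDimensional ℝ E]
  [NormedAddCommGroup F] [NormedSpace ℝ F] [FiniteDimensional ℝ F]
  {H M : Type*} [TopologicalSpace H] [ChartedSpace E H]
  [TopologicalSpace M] [ChartedSpace F M] [IsManifold 𝓘(ℝ, F) ∞ M]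

/-- A smooth open map of manifolds has a smooth local section through some point. -/
theorem IsOpenMap.exists_contMDiffAt_local_section [IsManifold 𝓘(ℝ, E) ∞ H] [Nonempty H]
    {f : H → M}
    (hopen : IsOpenMap f) (hf : ContMDiff 𝓘(ℝ, E) 𝓘(ℝ, F) ∞ f) :
    ∃ (h : H) (σ : M → H), ContMDiffAt 𝓘(ℝ, F) 𝓘(ℝ, E) ∞ σ (f h) ∧
      ∀ᶠ y in 𝓝 (f h), f (σ y) = y := by
  obtain ⟨h₀⟩ := ‹Nonempty H›
  let φ := chartAt E h₀
  let ψ := chartAt F (f h₀)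
  have hφ : ContMDiffOn 𝓘(ℝ, E) 𝓘(ℝ, E) ∞ φ.symm φ.target := contMDiffOn_chart_symm
  have hψ : ContMDiffOn 𝓘(ℝ, F) 𝓘(ℝ, F) ∞ ψ ψ.source := contMDiffOn_chart
  let g : E → F := ψ ∘ f ∘ φ.symm
  let U : Set E := φ.target ∩ φ.symm ⁻¹' (f ⁻¹' ψ.source)
  have hU : IsOpen U := φ.isOpen_inter_preimage_symm (ψ.open_source.preimage hf.continuous)
  have hne : U.Nonempty := ⟨φ h₀, φ.map_source (mem_chart_source E h₀), by
    rw [Set.mem_preimage, φ.left_inv (mem_chart_source E h₀)]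
    exact mem_chart_source F (f h₀)⟩
  have hg : ContDiffOn ℝ ∞ g U := by
    rw [← contMDiffOn_iff_contDiffOn]
    exact hψ.comp (hf.comp_contMDiffOn (hφ.mono Set.inter_subset_left)) fun x hx => hx.2
  obtain ⟨e, heU, he⟩ := hg.exists_surjective_fderiv_of_isOpen_image hU hne (by
    intro V hVU hV
    have h1 := hopen _ (φ.isOpen_image_symm_of_subset_target hV
      (hVU.trans Set.inter_subset_left))
    have h2 := ψ.isOpen_image_of_subset_source h1 (by
      rintro _ ⟨_, ⟨x, hx, rfl⟩, rfl⟩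
      exact (hVU hx).2)
    rwa [Set.image_image, Set.image_image] at h2)
  obtain ⟨τ, hτ, hτe, hτg⟩ := (hg.contDiffAt (hU.mem_nhds heU)).exists_local_section he
  have hsrc : f (φ.symm e) ∈ ψ.source := heU.2
  have hψat : ContMDiffAt 𝓘(ℝ, F) 𝓘(ℝ, F) ∞ ψ (f (φ.symm e)) :=
    hψ.contMDiffAt (ψ.open_source.mem_nhds hsrc)
  refine ⟨φ.symm e, φ.symm ∘ τ ∘ ψ, ?_, ?_⟩
  · refine ContMDiffAt.comp (f (φ.symm e)) ?_ (ContMDiffAt.comp _ hτ.contMDiffAt hψat)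
    have : (τ ∘ ψ) (f (φ.symm e)) = e := hτe
    rw [this]
    exact hφ.contMDiffAt (φ.open_target.mem_nhds heU.1)
  · have h1 := hψat.continuousAt.eventually hτg
    have h2 : ContinuousAt (τ ∘ ψ) (f (φ.symm e)) :=
      ContinuousAt.comp (f := ψ) hτ.continuousAt hψat.continuousAt
    -- `h1` only gives equality after applying `ψ`; staying in `U` puts `f (σ y)` in the source of
    -- `ψ`, where `ψ` is injective.
    have h3 := h2.eventually (show U ∈ 𝓝 ((τ ∘ ψ) (f (φ.symm e))) by
      rw [show (τ ∘ ψ) (f (φ.symm e)) = e from hτe]; exact hU.mem_nhds heU)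
    filter_upwards [h1, h3, ψ.open_source.mem_nhds hsrc] with y hy1 hy3 hys
    exact ψ.injOn hy3.2 hys hy1

/-- The orbit map of a smooth transitive action of a second countable Lie group has smooth local
sections everywhere. -/
theorem exists_contMDiffAt_section_orbitMap [Group H] [LieGroup 𝓘(ℝ, E) ∞ H]
    [SecondCountableTopology H] [T2Space M] [MulAction H M]
    [ContMDiffSMul 𝓘(ℝ, E) 𝓘(ℝ, F) ∞ H M] [MulAction.IsPretransitive H M] (x₀ x : M) :
    ∃ σ : M → H, ContMDiffAt 𝓘(ℝ, F) 𝓘(ℝ, E) ∞ σ x ∧ ∀ᶠ y in 𝓝 x, σ y • x₀ = y := by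
  have : IsTopologicalGroup H := topologicalGroup_of_lieGroup 𝓘(ℝ, E) ∞
  have : ContinuousSMul H M := ContMDiffSMul.continuousSMul (I := 𝓘(ℝ, E)) (I' := 𝓘(ℝ, F)) ∞
  have : LocallyCompactSpace H := Manifold.locallyCompact_of_finiteDimensional 𝓘(ℝ, E)
  have : LocallyCompactSpace M := Manifold.locallyCompact_of_finiteDimensional 𝓘(ℝ, F)
  have hsm : ContMDiff 𝓘(ℝ, E) 𝓘(ℝ, F) ∞ (fun h : H => h • x₀) :=
    contMDiff_id.smul contMDiff_const
  -- Openness of the orbit map is where second countability enters: with local compactness it makes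
  -- `H` σ-compact, and `M` is a Baire space.
  obtain ⟨h, σ, hσ, hσx⟩ :=
    (isOpenMap_smul_of_sigmaCompact (G := H) x₀).exists_contMDiffAt_local_section hsm
  -- The section exists near some point of the orbit only; translating by `g` transports it to `x`.
  obtain ⟨g, hg⟩ := MulAction.exists_smul_eq H x (h • x₀)
  have hgs : ContMDiff 𝓘(ℝ, F) 𝓘(ℝ, F) ∞ (fun y : M => g • y) :=
    ContMDiffSMul.contMDiff_const_smul (I := 𝓘(ℝ, E)) g
  refine ⟨fun y => g⁻¹ * σ (g • y), ?_, ?_⟩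
  · have h1 : ContMDiffAt 𝓘(ℝ, F) 𝓘(ℝ, E) ∞ (σ ∘ fun y => g • y) x :=
      ContMDiffAt.comp x (by simpa only [hg] using hσ) hgs.contMDiffAt
    exact contMDiffAt_const.mul h1
  · have h2 : ∀ᶠ y in 𝓝 x, σ (g • y) • x₀ = g • y :=
      hgs.continuous.continuousAt.eventually (p := fun y => σ y • x₀ = y) (by simpa only [hg] using hσx)
    filter_upwards [h2] with y hy
    rw [mul_smul, hy, inv_smul_smul]

end Manifold

/-! ### Negation on the tangent bundle -/

section TangentNeg

variable {E M E' M' : Type*} [NormedAddCommGroup E] [NormedSpace ℝ E]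
  [TopologicalSpace M] [ChartedSpace E M]
  [NormedAddCommGroup E'] [NormedSpace ℝ E'] [TopologicalSpace M'] [ChartedSpace E' M']

/-- Fibrewise negation on the tangent bundle. -/
noncomputable def tangentNeg (p : TangentBundle 𝓘(ℝ, E) M) : TangentBundle 𝓘(ℝ, E) M :=
  ⟨p.proj, -p.snd⟩

theorem tangentMap_tangentNeg (f : M → M') (p : TangentBundle 𝓘(ℝ, E) M) :
    tangentMap 𝓘(ℝ, E) 𝓘(ℝ, E') f (tangentNeg p) =
      tangentNeg (tangentMap 𝓘(ℝ, E) 𝓘(ℝ, E') f p) :=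
  congrArg (Bundle.TotalSpace.mk (f p.proj)) (map_neg (mfderiv 𝓘(ℝ, E) 𝓘(ℝ, E') f p.proj) p.snd)

end TangentNeg

/-! ### Conjugation of symmetries by automorphisms -/

namespace CartanGeometry

variable {EG G EP P : Type*} [NormedAddCommGroup EG] [NormedSpace ℝ EG]
  [TopologicalSpace G] [ChartedSpace EG G] [Group G]
  [NormedAddCommGroup EP] [NormedSpace ℝ EP]
  [TopologicalSpace P] [ChartedSpace EP P] [Group P]
  {ι : P →* G}
  {EB B : Type*} [NormedAddCommGroup EB] [NormedSpace ℝ EB]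
  [TopologicalSpace B] [ChartedSpace EB B] [IsManifold 𝓘(ℝ, EB) ∞ B]
  {EM M : Type*} [NormedAddCommGroup EM] [NormedSpace ℝ EM]
  [TopologicalSpace M] [ChartedSpace EM M]
  {𝒢 : CartanGeometry (EG := EG) (EP := EP) ι (EB := EB) B (EM := EM) M}

theorem IsAutomorphism.trans {φ ψ : B ≃ₘ^∞⟮𝓘(ℝ, EB), 𝓘(ℝ, EB)⟯ B}
    (hφ : 𝒢.IsAutomorphism φ) (hψ : 𝒢.IsAutomorphism ψ) : 𝒢.IsAutomorphism (φ.trans ψ) where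
  map_act u p := by
    simp only [Diffeomorph.coe_trans, Function.comp_apply, hφ.map_act, hψ.map_act]
  map_conn u v := by
    have hd : ∀ (χ : B ≃ₘ^∞⟮𝓘(ℝ, EB), 𝓘(ℝ, EB)⟯ B) (w : B),
        MDifferentiableAt 𝓘(ℝ, EB) 𝓘(ℝ, EB) χ w := fun χ w =>
      χ.contMDiff.contMDiffAt.mdifferentiableAt (by simp)
    rw [Diffeomorph.coe_trans, mfderiv_comp u (hd ψ (φ u)) (hd φ u)]
    exact (hψ.map_conn (φ u) _).trans (hφ.map_conn u v)

theorem IsCoveredByAutomorphism.comp {f g : M → M} (hf : 𝒢.IsCoveredByAutomorphism f)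
    (hg : 𝒢.IsCoveredByAutomorphism g) : 𝒢.IsCoveredByAutomorphism (f ∘ g) := by
  obtain ⟨φ, hφ, hφf⟩ := hf
  obtain ⟨ψ, hψ, hψg⟩ := hg
  refine ⟨ψ.trans φ, hψ.trans hφ, fun u => ?_⟩
  simp only [Diffeomorph.coe_trans, Function.comp_apply, hφf, hψg]

/-- If `h` and its inverse are covered by automorphisms, then conjugation by `h` sends symmetries
centered at `x` to symmetries centered at `h x`. -/
theorem IsSymmetry.conj {x : M} {s : M ≃ₘ^∞⟮𝓘(ℝ, EM), 𝓘(ℝ, EM)⟯ M} (hs : 𝒢.IsSymmetry x s)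
    (h : M ≃ₘ^∞⟮𝓘(ℝ, EM), 𝓘(ℝ, EM)⟯ M) (hh : 𝒢.IsCoveredByAutomorphism h)
    (hh' : 𝒢.IsCoveredByAutomorphism h.symm) [IsManifold 𝓘(ℝ, EM) ∞ M] :
    𝒢.IsSymmetry (h x) ((h.symm.trans s).trans h) where
  map_center := by simp [hs.map_center]
  covered := hh.comp (hs.covered.comp hh')
  tangentMap_eq v := by
    have hd : ∀ χ : M ≃ₘ^∞⟮𝓘(ℝ, EM), 𝓘(ℝ, EM)⟯ M, MDifferentiable 𝓘(ℝ, EM) 𝓘(ℝ, EM) χ :=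
      fun χ => χ.contMDiff.mdifferentiable (by simp)
    -- Stated on the total space because `h.symm (h x)` is only propositionally equal to `x`; this
    -- avoids transporting tangent vectors between fibres.
    have hneg : ∀ p : TangentBundle 𝓘(ℝ, EM) M, p.proj = x →
        tangentMap 𝓘(ℝ, EM) 𝓘(ℝ, EM) s p = tangentNeg p := by
      rintro ⟨_, w⟩ rfl
      exact hs.tangentMap_eq w
    have hid : tangentMap 𝓘(ℝ, EM) 𝓘(ℝ, EM) h
        (tangentMap 𝓘(ℝ, EM) 𝓘(ℝ, EM) h.symm ⟨h x, v⟩) = ⟨h x, v⟩ := by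
      rw [← tangentMap_comp_at _ (hd h _) (hd h.symm _)]
      have : (h ∘ h.symm : M → M) = id := funext h.apply_symm_apply
      rw [this, tangentMap_id, id]
    rw [Diffeomorph.coe_trans, Diffeomorph.coe_trans,
      tangentMap_comp_at _ (hd h _) ((hd s).comp (hd h.symm) _),
      tangentMap_comp_at _ (hd s _) (hd h.symm _),
      hneg _ (h.symm_apply_apply x), tangentMap_tangentNeg, hid]
    rfl

end CartanGeometry

/-! ### The smooth system of symmetries -/

theorem mainTheorem4
    -- the Lie groups `G` and `P`, with `P` parabolic in the semisimple group `G`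
    {EG G EP P : Type*}
    [NormedAddCommGroup EG] [NormedSpace ℝ EG] [FiniteDimensional ℝ EG]
    [TopologicalSpace G] [ChartedSpace EG G] [Group G] [LieGroup 𝓘(ℝ, EG) ∞ G]
    [NormedAddCommGroup EP] [NormedSpace ℝ EP] [FiniteDimensional ℝ EP]
    [TopologicalSpace P] [ChartedSpace EP P] [Group P] [LieGroup 𝓘(ℝ, EP) ∞ P]
    [LieAlgebra.IsSemisimple ℝ (GroupLieAlgebra 𝓘(ℝ, EG) G)]
    (gr : OneGrading (GroupLieAlgebra 𝓘(ℝ, EG) G))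
    (ι : P →* G) (_hP : IsParabolicSubgroup (EP := EP) gr ι) (_heff : IsEffectivePair ι)
    -- the geometry
    {EB B EM M : Type*}
    [NormedAddCommGroup EB] [NormedSpace ℝ EB] [FiniteDimensional ℝ EB]
    [TopologicalSpace B] [ChartedSpace EB B] [IsManifold 𝓘(ℝ, EB) ∞ B]
    [NormedAddCommGroup EM] [NormedSpace ℝ EM] [FiniteDimensional ℝ EM]
    [TopologicalSpace M] [ChartedSpace EM M] [IsManifold 𝓘(ℝ, EM) ∞ M]
    [T2Space M] [SecondCountableTopology M] [ConnectedSpace M]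
    (𝒢 : CartanGeometry (EG := EG) (EP := EP) ι (EB := EB) B (EM := EM) M)
    -- the Lie group `H`, acting smoothly and transitively on `M` by (base maps of) automorphisms
    {EH H : Type*}
    [NormedAddCommGroup EH] [NormedSpace ℝ EH] [FiniteDimensional ℝ EH]
    [TopologicalSpace H] [ChartedSpace EH H] [Group H] [LieGroup 𝓘(ℝ, EH) ∞ H]
    [T2Space H] [SecondCountableTopology H]
    [MulAction H M] [ContMDiffSMul 𝓘(ℝ, EH) 𝓘(ℝ, EM) ∞ H M] [MulAction.IsPretransitive H M]
    (_haut : ∀ h : H, 𝒢.IsCoveredByAutomorphism (fun x : M => h • x))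
    -- the symmetry at `x₀`, commuting with the stabilizer of `x₀`
    (x₀ : M) (s : M ≃ₘ^∞⟮𝓘(ℝ, EM), 𝓘(ℝ, EM)⟯ M) (_hs : 𝒢.IsSymmetry x₀ s)
    (_hcomm : ∀ k ∈ MulAction.stabilizer H x₀, ∀ y : M, k • s (k⁻¹ • y) = s y) :
    ∃ S : M → M ≃ₘ^∞⟮𝓘(ℝ, EM), 𝓘(ℝ, EM)⟯ M,
      (∀ (h : H) (y : M), S (h • x₀) y = h • s (h⁻¹ • y)) ∧ 𝒢.IsSmoothSystem S := by
  let D : H → M ≃ₘ^∞⟮𝓘(ℝ, EM), 𝓘(ℝ, EM)⟯ M := Diffeomorph.smul 𝓘(ℝ, EH) 𝓘(ℝ, EM) ∞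
  -- No continuity of `g` is needed: `hS` shows that `S` is independent of this choice.
  choose g hg using MulAction.exists_smul_eq H x₀
  let S : M → M ≃ₘ^∞⟮𝓘(ℝ, EM), 𝓘(ℝ, EM)⟯ M := fun x => ((D (g x)).symm.trans s).trans (D (g x))
  have hS : ∀ (h : H) (y : M), S (h • x₀) y = h • s (h⁻¹ • y) := by
    intro h y
    change g (h • x₀) • s ((g (h • x₀))⁻¹ • y) = h • s (h⁻¹ • y)
    have hk : h⁻¹ * g (h • x₀) ∈ MulAction.stabilizer H x₀ := by
      rw [MulAction.mem_stabilizer_iff, mul_smul, hg, inv_smul_smul]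
    -- With `k = h⁻¹ * g (h • x₀)`, replacing `s` by its conjugate under `k` turns conjugation by
    -- `h` into conjugation by `h * k = g (h • x₀)`.
    rw [← _hcomm _ hk (h⁻¹ • y), smul_smul, smul_smul]
    congr 2 <;> group
  refine ⟨S, hS, fun x => ?_, fun q => ?_⟩
  · have := _hs.conj (D (g x)) (_haut (g x)) (_haut (g x)⁻¹)
    rwa [show D (g x) x₀ = x from hg x] at this
  -- Near `q.1` the arbitrary choice `g` may be replaced by a smooth section, by `hS`.
  · obtain ⟨σ, hσ, hσx⟩ := exists_contMDiffAt_section_orbitMap (E := EH) (F := EM) (H := H) x₀ q.1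
    have h1 : ContMDiffAt (𝓘(ℝ, EM).prod 𝓘(ℝ, EM)) 𝓘(ℝ, EH) ∞ (fun r : M × M => σ r.1) q :=
      ContMDiffAt.comp q hσ contMDiffAt_fst
    have h2 : ContMDiffAt (𝓘(ℝ, EM).prod 𝓘(ℝ, EM)) 𝓘(ℝ, EM) ∞
        (fun r : M × M => σ r.1 • s ((σ r.1)⁻¹ • r.2)) q :=
      h1.smul (s.contMDiff.contMDiffAt.comp q (h1.inv.smul contMDiffAt_snd))
    refine h2.congr_of_eventuallyEq ?_
    filter_upwards [continuousAt_fst.eventually hσx] with r hr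
    have := hS (σ r.1) r.2
    rwa [hr] at this
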